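/- Let $a,b,c,d$ be complex numbers with strictly positive real parts which are all real, or consist of two reals and one complex conjugate pair, or consist of two complex conjugate pairs. For $x>0$ put $$f(x;a,b,c,d)=K(a,b,c,d)\,\frac{\left|\Gamma(a+i\sqrt{x})\,\Gamma(b+i\sqrt{x})\,\Gamma(c+i\sqrt{x})\,\Gamma(d+i\sqrt{x})\right|^2}{\sqrt{x}\,\left|\Gamma(2i\sqrt{x})\right|^2},$$ where $$K(a,b,c,d)=\frac{\Gamma(a+b+c+d)}{4\pi\,\Gamma(a+b)\Gamma(a+c)\Gamma(b+c)\Gamma(a+d)\Gamma(b+d)\Gamma(c+d)}.$$ If a random variable $X$ has density $f(x;a,b,c,d)$ on $(0,\infty)$, then $X$ is square integrable, $$\mathbb{E}(X)=\frac{abc+abd+acd+bcd}{a+b+c+d}$$ and $$\mathrm{Var}(X)=\frac{(a+b)(a+c)(b+c)(a+d)(b+d)(c+d)}{(a+b+c+d)^2(a+b+c+d+1)}.$$ -/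

import Mathlib

/-- The numbers `z`, `w` are both real, or they are complex conjugates of each other. -/
def RealOrConjPair (z w : ℂ) : Prop :=
  (z.im = 0 ∧ w.im = 0) ∨ w = starRingEnd ℂ z

/-- Admissible parameters of the Wilson density: all four real parts are strictly positive, and
`a, b, c, d` are all real, or consist of two reals and one conjugate pair, or of two conjugate
pairs (in any of the possible positions). -/
structure WilsonAdmissible (a b c d : ℂ) : Prop where
  re_a : 0 < a.re
  re_b : 0 < b.re
  re_c : 0 < c.re
  re_d : 0 < d.re
  pairs : (RealOrConjPair a b ∧ RealOrConjPair c d) ∨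
    (RealOrConjPair a c ∧ RealOrConjPair b d) ∨
    (RealOrConjPair a d ∧ RealOrConjPair b c)

/-- The normalizing constant
`K(a,b,c,d) = Γ(a+b+c+d) / (4π Γ(a+b) Γ(a+c) Γ(b+c) Γ(a+d) Γ(b+d) Γ(c+d))`. -/
noncomputable def wilsonK (a b c d : ℂ) : ℂ :=
  Complex.Gamma (a + b + c + d) /
    (4 * (Real.pi : ℂ) * Complex.Gamma (a + b) * Complex.Gamma (a + c) * Complex.Gamma (b + c) *
      Complex.Gamma (a + d) * Complex.Gamma (b + d) * Complex.Gamma (c + d))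

/-- For admissible parameters the normalizing constant is real, so that taking its real part in
`wilsonDensity` loses nothing. -/
theorem wilsonK_im_eq_zero {a b c d : ℂ} (h : WilsonAdmissible a b c d) :
    (wilsonK a b c d).im = 0 := by
  rw [← Complex.conj_eq_iff_im]
  have key : starRingEnd ℂ (wilsonK a b c d) = wilsonK (starRingEnd ℂ a) (starRingEnd ℂ b)
      (starRingEnd ℂ c) (starRingEnd ℂ d) := by
    simp only [wilsonK, map_div₀, map_mul, ← Complex.Gamma_conj, map_add, Complex.conj_ofReal,
      map_ofNat]
  have e : ∀ z w : ℂ, RealOrConjPair z w →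
      (starRingEnd ℂ z = z ∧ starRingEnd ℂ w = w) ∨
        (starRingEnd ℂ z = w ∧ starRingEnd ℂ w = z) := by
    rintro z w (⟨hz, hw⟩ | rfl)
    · exact Or.inl ⟨Complex.conj_eq_iff_im.2 hz, Complex.conj_eq_iff_im.2 hw⟩
    · exact Or.inr ⟨rfl, Complex.conj_conj z⟩
  rw [key]
  rcases h.pairs with ⟨h1, h2⟩ | ⟨h1, h2⟩ | ⟨h1, h2⟩ <;>
  rcases e _ _ h1 with ⟨p, q⟩ | ⟨p, q⟩ <;> rcases e _ _ h2 with ⟨r, s⟩ | ⟨r, s⟩ <;>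
  · rw [p, q, r, s]
    try (simp only [wilsonK]; congr 1 <;> ring_nf)

/-- The four-parameter Wilson density, as a function of `x > 0`:
`f(x;a,b,c,d) = K(a,b,c,d) |Γ(a+i√x) Γ(b+i√x) Γ(c+i√x) Γ(d+i√x)|² / (√x |Γ(2i√x)|²)`. -/
noncomputable def wilsonDensity (a b c d : ℂ) (x : ℝ) : ℝ :=
  (wilsonK a b c d).re *
    (‖Complex.Gamma (a + Complex.I * (√x : ℝ)) * Complex.Gamma (b + Complex.I * (√x : ℝ)) *
        Complex.Gamma (c + Complex.I * (√x : ℝ)) * Complex.Gamma (d + Complex.I * (√x : ℝ))‖ ^ 2 /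
      (√x * ‖Complex.Gamma (2 * Complex.I * (√x : ℝ))‖ ^ 2))

/-!
The moments of the Wilson density satisfy linear relations that come from a single contour shift,
and these determine the mean and the variance once the total mass is known to be `1`. The
evaluation of the Wilson integral itself is not needed, since the law of `X` is a probability
measure by assumption.

After the substitution `x = y²`, and with `s = iy`, the density becomes a constant times
`s sin(2πs) ∏ₚ Γ(p + s) Γ(p - s)`, the product being over the parameters `p = a, b, c, d`
(`two_mul_wilsonDensity_sq`): the conjugates are removed because conjugation permutes the parameters,
and `|Γ(2iy)|²` is elementary by the reflection formula. The function
`sin(2πs) q(s) ∏ₚ Γ(p + s) Γ(p + 1 - s)` with `q(1 - s) = q(s)` is holomorphic for `0 ≤ Re s ≤ 1`,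
so its integrals over the two boundary lines agree; by `Γ(z + 1) = z Γ(z)` this says
(`integral_gammaStrip_shift`) that the odd part of `q(s) ∏ₚ (p - s)` integrates to zero against
`sin(2πs) ∏ₚ Γ(p + s) Γ(p - s)`. With `eⱼ` the elementary symmetric functions of the parameters,
`q = 1` gives `e₃ = e₁ E(X)` and `q = s(1 - s)` gives `e₄ - (e₂ + e₃) E(X) + (1 + e₁) E(X²) = 0`.

Convergence at infinity rests on the bound `|Γ(x + iy)| ≤ 2ˣ Γ(x) exp(-π|y|/3)` (`norm_Gamma_le`),
obtained by rotating the ray of integration in Euler's integral by the angle `±π/3`.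
-/

open Complex MeasureTheory Filter Topology

/-! ### Decay of the Gamma function on vertical lines -/

/-- Mathlib has this for real `r > 0`; both sides are holomorphic in `r` on the right half-plane, so
the identity theorem extends it to `0 < r.re`. -/
theorem Gamma_eq_cpow_mul_integral {z r : ℂ} (hz : 0 < z.re) (hr : 0 < r.re) :
    Gamma z = r ^ z * ∫ t : ℝ in Set.Ioi 0, (t : ℂ) ^ (z - 1) * exp (-(r * t)) := by
  set U : Set ℂ := {w | 0 < w.re} with hU
  have hUo : IsOpen U := isOpen_lt continuous_const continuous_re
  have hUc : IsPreconnected U := (convex_halfSpace_re_gt 0).isPreconnected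
  have hmeas : ∀ w : ℂ, AEStronglyMeasurable (fun t : ℝ => (t : ℂ) ^ (z - 1) * exp (-(w * t)))
      (volume.restrict (Set.Ioi 0)) := fun w => by
    refine ContinuousOn.aestronglyMeasurable (fun t ht => ?_) measurableSet_Ioi
    refine ContinuousAt.continuousWithinAt (ContinuousAt.mul ?_ (by fun_prop))
    exact continuousAt_ofReal_cpow_const t _ (Or.inr (ne_of_gt ht))
  have hnorm : ∀ (u w : ℂ) (t : ℝ), t ∈ Set.Ioi 0 →
      ‖(t : ℂ) ^ u * exp (-(w * t))‖ = t ^ u.re * Real.exp (-w.re * t) := fun u w t ht => by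
    rw [norm_mul, norm_cpow_eq_rpow_re_of_pos ht, norm_exp]; simp
  have hint : ∀ {u b : ℝ}, -1 < u → 0 < b →
      IntegrableOn (fun t : ℝ => t ^ u * Real.exp (-b * t)) (Set.Ioi 0) := fun hu hb => by
    simpa using integrableOn_rpow_mul_exp_neg_mul_rpow (p := 1) hu one_pos hb
  have hdiff : DifferentiableOn ℂ
      (fun w => ∫ t : ℝ in Set.Ioi 0, (t : ℂ) ^ (z - 1) * exp (-(w * t))) U := by
    intro w hw
    have hw' : 0 < w.re := hw
    refine (hasDerivAt_integral_of_dominated_loc_of_deriv_le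
      (F' := fun w t => (t : ℂ) ^ (z - 1) * (exp (-(w * t)) * -t))
      (bound := fun t => t ^ z.re * Real.exp (-(w.re / 2) * t))
      (Metric.ball_mem_nhds w (half_pos hw')) (.of_forall hmeas) ?_ ?_ ?_
      (hint (by linarith) (half_pos hw')) ?_).2.differentiableAt.differentiableWithinAt
    · refine (hint (u := z.re - 1) (by linarith) hw').mono' (hmeas w) ?_
      filter_upwards [ae_restrict_mem measurableSet_Ioi] with t ht
      rw [hnorm _ _ t ht]; simp
    · simp_rw [← mul_assoc]
      exact (hmeas w).mul (by fun_prop)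
    · filter_upwards [ae_restrict_mem measurableSet_Ioi] with t ht v hv
      have ht' : 0 < t := ht
      rw [← mul_assoc, norm_mul, hnorm _ _ t ht, norm_neg, norm_real, Real.norm_of_nonneg ht'.le,
        mul_right_comm, sub_re, one_re, ← Real.rpow_add_one ht'.ne', sub_add_cancel]
      have h1 : w.re / 2 ≤ v.re := by
        have h2 := (abs_re_le_norm (v - w)).trans_lt (mem_ball_iff_norm.1 hv)
        rw [sub_re] at h2
        linarith [(abs_lt.1 h2).1]
      gcongr
    · refine .of_forall fun t v _ => ?_
      have h1 : HasDerivAt (fun w : ℂ => -(w * t)) (-t : ℂ) v := by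
        simpa using (hasDerivAt_id v).mul_const (-t : ℂ)
      exact h1.cexp.const_mul _
  have hpow : DifferentiableOn ℂ (fun w : ℂ => w ^ z) U := fun w hw =>
    ((differentiableAt_id).cpow_const (Or.inl hw)).differentiableWithinAt
  have hf := (hpow.mul hdiff).analyticOnNhd hUo
  have hg : AnalyticOnNhd ℂ (fun _ => Gamma z) U := analyticOnNhd_const
  refine (hf.eqOn_of_preconnected_of_frequently_eq hg hUc (z₀ := 1) (by simp [hU]) ?_ hr).symm
  have hpos : ∀ x : ℝ, 0 < x → (x : ℂ) ^ z *
      ∫ t : ℝ in Set.Ioi 0, (t : ℂ) ^ (z - 1) * exp (-(x * t)) = Gamma z := fun x hx => by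
    have hx' : (x : ℂ) ≠ 0 := ofReal_ne_zero.2 hx.ne'
    rw [integral_cpow_mul_exp_neg_mul_Ioi hz hx, one_div, inv_cpow _ _
      (by rw [arg_ofReal_of_nonneg hx.le]; exact Real.pi_pos.ne), mul_inv_cancel_left₀]
    simp [cpow_eq_zero_iff, hx']
  have hlim : Tendsto (fun x : ℝ => (x : ℂ)) (𝓝[≠] 1) (𝓝[≠] 1) := by
    refine tendsto_nhdsWithin_iff.2 ⟨?_, ?_⟩
    · exact (continuous_ofReal.tendsto' 1 1 ofReal_one).mono_left nhdsWithin_le_nhds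
    · filter_upwards [self_mem_nhdsWithin] with x hx
      simpa using hx
  refine hlim.frequently (Eventually.frequently ?_)
  filter_upwards [nhdsWithin_le_nhds (lt_mem_nhds one_pos)] with x hx using hpos x hx

/-- Taking `r = exp (t * I)` in the integral for `Γ z` (a rotation of the ray of integration) gives
exponential decay in `z.im` at rate `t`. -/
theorem norm_Gamma_le_of_cos_pos {z : ℂ} (hz : 0 < z.re) {t : ℝ} (ht : 0 < Real.cos t)
    (ht1 : -Real.pi < t) (ht2 : t ≤ Real.pi) :
    ‖Gamma z‖ ≤ (1 / Real.cos t) ^ z.re * Real.Gamma z.re * Real.exp (-(t * z.im)) := by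
  have hre : (exp (t * I)).re = Real.cos t := exp_ofReal_mul_I_re t
  rw [Gamma_eq_cpow_mul_integral hz (r := exp (t * I)) (by rwa [hre]),
    cpow_def_of_ne_zero (exp_ne_zero _), log_exp (by simpa) (by simpa), norm_mul, norm_exp,
    ← Real.integral_rpow_mul_exp_neg_mul_Ioi hz ht, mul_comm]
  have e : (t * I * z).re = -(t * z.im) := by simp
  rw [e]
  gcongr
  refine (norm_integral_le_integral_norm _).trans (le_of_eq ?_)
  refine setIntegral_congr_fun measurableSet_Ioi fun x hx => ?_
  simp only [norm_mul, norm_cpow_eq_rpow_re_of_pos hx, norm_exp]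
  simp [exp_ofReal_mul_I_re]

/-- The rate `π / 3` is a convenient choice: eight such factors beat the growth `exp (2 π |y|)` of
`sin (2 π s)`, which only needs a rate above `π / 4`. -/
theorem norm_Gamma_le {z : ℂ} (hz : 0 < z.re) :
    ‖Gamma z‖ ≤ 2 ^ z.re * Real.Gamma z.re * Real.exp (-(Real.pi / 3 * |z.im|)) := by
  have hpi := Real.pi_pos
  rcases le_total 0 z.im with h | h
  · have := norm_Gamma_le_of_cos_pos hz (t := Real.pi / 3) (by norm_num [Real.cos_pi_div_three])
      (by linarith) (by linarith)
    rwa [Real.cos_pi_div_three, one_div_one_div, ← abs_of_nonneg h] at this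
  · have := norm_Gamma_le_of_cos_pos hz (t := -(Real.pi / 3))
      (by norm_num [Real.cos_pi_div_three]) (by linarith) (by linarith)
    rwa [Real.cos_neg, Real.cos_pi_div_three, one_div_one_div, neg_mul, ← mul_neg,
      ← abs_of_nonpos h] at this

/-- Decay of `Γ (p + s)` along vertical lines, uniform over a closed strip. -/
theorem exists_norm_Gamma_add_le {p : ℂ} {x₀ x₁ : ℝ} (h : 0 < p.re + x₀) :
    ∃ C : ℝ, ∀ s : ℂ, s.re ∈ Set.Icc x₀ x₁ →
      ‖Gamma (p + s)‖ ≤ C * Real.exp (-(Real.pi / 3 * |s.im|)) := by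
  have hc : ContinuousOn (fun x : ℝ => (2 : ℝ) ^ (p.re + x) * Real.Gamma (p.re + x))
      (Set.Icc x₀ x₁) := by
    intro x hx
    have hG : ContinuousAt Real.Gamma (p.re + x) :=
      (Real.differentiableAt_Gamma fun m hm => by
        have := hx.1; have : (0 : ℝ) ≤ m := m.cast_nonneg; linarith).continuousAt
    refine ContinuousAt.continuousWithinAt (ContinuousAt.mul ?_ ?_)
    · exact (Real.continuous_const_rpow (by norm_num)).continuousAt.comp (by fun_prop)
    · exact hG.comp (f := fun x => p.re + x) (by fun_prop)
  obtain ⟨C, hC⟩ := isCompact_Icc.exists_bound_of_continuousOn hc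
  refine ⟨C * Real.exp (Real.pi / 3 * |p.im|), fun s hs => ?_⟩
  have hpos : 0 < (p + s).re := by rw [add_re]; linarith [hs.1]
  refine (norm_Gamma_le hpos).trans ?_
  have h1 := (le_abs_self _).trans (hC _ hs)
  have h2 : |s.im| ≤ |p.im| + |(p + s).im| := by
    have := abs_sub (p + s).im p.im
    rw [add_im, add_sub_cancel_left] at this
    rw [add_im]; linarith
  have h0 : 0 ≤ C := (norm_nonneg _).trans (hC _ hs)
  rw [mul_assoc C, ← Real.exp_add, add_re]
  refine mul_le_mul h1 (Real.exp_le_exp.2 ?_) (Real.exp_nonneg _) h0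
  nlinarith [Real.pi_pos]

/-! ### The kernel on a vertical strip -/

/-- The function `sin (2πs) ∏ᵢ Γ(pᵢ + s) Γ(pᵢ + δ - s)`, holomorphic for `0 ≤ Re s ≤ δ` when all
`pᵢ` have positive real part. For `δ = 0` and `s = iy` it is, up to an elementary factor, the Wilson weight with parameters `pᵢ`, because
`1 / (Γ(2s) Γ(-2s)) = -2s sin(2πs) / π`. For `δ = 1` the product is symmetric under `s ↦ 1 - s`. -/
noncomputable def gammaStrip (δ : ℝ) (p : Fin 4 → ℂ) (s : ℂ) : ℂ :=
  sin (2 * Real.pi * s) * ∏ i, (Gamma (p i + s) * Gamma (p i + δ - s))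

theorem norm_sin_le_exp_abs_im (z : ℂ) : ‖sin z‖ ≤ Real.exp |z.im| := by
  rw [sin, norm_div, norm_mul, norm_I, mul_one]
  have h := norm_sub_le (exp (-z * I)) (exp (z * I))
  rw [norm_exp, norm_exp] at h
  have h1 : Real.exp (-z * I).re ≤ Real.exp |z.im| :=
    Real.exp_le_exp.2 (by simpa using le_abs_self _)
  have h2 : Real.exp (z * I).re ≤ Real.exp |z.im| :=
    Real.exp_le_exp.2 (by simpa using neg_le_abs _)
  rw [div_le_iff₀ (by norm_num)]
  rw [norm_ofNat]
  linarith

theorem exists_norm_gammaStrip_le {δ : ℝ} {p : Fin 4 → ℂ} (hp : ∀ i, 0 < (p i).re) :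
    ∃ C : ℝ, 0 ≤ C ∧ ∀ s : ℂ, s.re ∈ Set.Icc 0 δ →
      ‖gammaStrip δ p s‖ ≤ C * Real.exp (-(2 * |s.im|)) := by
  have h1 : ∀ i, ∃ C : ℝ, ∀ s : ℂ, s.re ∈ Set.Icc 0 δ →
      ‖Gamma (p i + s)‖ ≤ C * Real.exp (-(Real.pi / 3 * |s.im|)) := fun i =>
    exists_norm_Gamma_add_le (by simpa using hp i)
  have h2 : ∀ i, ∃ C : ℝ, ∀ s : ℂ, s.re ∈ Set.Icc 0 δ →
      ‖Gamma (p i + δ - s)‖ ≤ C * Real.exp (-(Real.pi / 3 * |s.im|)) := fun i => by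
    obtain ⟨C, hC⟩ := exists_norm_Gamma_add_le (p := p i + δ) (x₀ := -δ) (x₁ := 0)
      (by simpa using hp i)
    refine ⟨C, fun s hs => ?_⟩
    simpa [sub_eq_add_neg] using hC (-s) (by simpa [and_comm] using hs)
  choose A hA using h1
  choose B hB using h2
  refine ⟨|∏ i, (A i * B i)|, abs_nonneg _, fun s hs => ?_⟩
  have hprod : ‖∏ i, (Gamma (p i + s) * Gamma (p i + δ - s))‖ ≤
      (∏ i, (A i * B i)) * Real.exp (-(2 * Real.pi / 3 * |s.im|)) ^ 4 := by
    rw [norm_prod]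
    have : (∏ i, (A i * B i)) * Real.exp (-(2 * Real.pi / 3 * |s.im|)) ^ 4 =
        ∏ i, (A i * B i * Real.exp (-(2 * Real.pi / 3 * |s.im|))) := by
      simp [Finset.prod_mul_distrib]
    rw [this]
    refine Finset.prod_le_prod (fun i _ => norm_nonneg _) fun i _ => ?_
    rw [norm_mul]
    refine (mul_le_mul (hA i s hs) (hB i s hs) (norm_nonneg _)
      ((norm_nonneg _).trans (hA i s hs))).trans (le_of_eq ?_)
    rw [mul_mul_mul_comm, ← Real.exp_add]
    ring_nf
  rw [gammaStrip, norm_mul]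
  have hs2 : ‖sin (2 * Real.pi * s)‖ ≤ Real.exp (2 * Real.pi * |s.im|) := by
    refine (norm_sin_le_exp_abs_im _).trans (le_of_eq ?_)
    have : (2 * Real.pi * s : ℂ).im = 2 * Real.pi * s.im := by simp
    rw [this, abs_mul, abs_of_pos (by positivity)]
  refine (mul_le_mul hs2 hprod (norm_nonneg _) (Real.exp_nonneg _)).trans ?_
  rw [mul_left_comm, ← Real.exp_nat_mul, ← Real.exp_add]
  refine mul_le_mul (le_abs_self _) (Real.exp_le_exp.2 ?_) (Real.exp_nonneg _) (abs_nonneg _)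
  push_cast
  -- The total rate is `8π/3 - 2π = 2π/3`, which exceeds `2` since `π > 3`.
  nlinarith [Real.pi_gt_three, abs_nonneg s.im]

theorem differentiableAt_gammaStrip {δ : ℝ} {p : Fin 4 → ℂ} (hp : ∀ i, 0 < (p i).re) {s : ℂ}
    (hs : s.re ∈ Set.Icc 0 δ) : DifferentiableAt ℂ (gammaStrip δ p) s := by
  have hG : ∀ z : ℂ, 0 < z.re → DifferentiableAt ℂ Gamma z := fun z hz =>
    differentiableAt_Gamma z fun m hm => by
      have : z.re = -m := by simp [hm]
      have : (0 : ℝ) ≤ m := m.cast_nonneg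
      linarith
  unfold gammaStrip
  refine DifferentiableAt.mul (by fun_prop) ?_
  refine DifferentiableAt.fun_finsetProd fun i _ => DifferentiableAt.mul ?_ ?_
  · exact (hG (p i + s) (by rw [add_re]; linarith [hp i, hs.1])).comp s (by fun_prop)
  · exact (hG (p i + δ - s) (by simp; linarith [hp i, hs.2])).comp s (by fun_prop)

/-! ### Shifting the contour -/

theorem integrable_exp_neg_abs : Integrable (fun y : ℝ => Real.exp (-|y|)) := by
  have h : IntegrableOn (fun y : ℝ => Real.exp (-|y|)) (Set.Ioi 0) :=
    (integrableOn_exp_neg_Ioi 0).congr_fun (fun y hy => by simp [abs_of_pos (show 0 < y from hy)])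
      measurableSet_Ioi
  rw [← integrableOn_univ, ← Set.Iic_union_Ioi (a := (0 : ℝ))]
  refine IntegrableOn.union ?_ h
  exact (integrableOn_exp_Iic 0).congr_fun
    (fun y hy => by simp [abs_of_nonpos (show y ≤ 0 from hy)]) measurableSet_Iic

/-- Cauchy's theorem in an infinite strip: a holomorphic function with exponential decay has the same
integral over both boundary lines. -/
theorem integral_vertical_sub_eq_zero {f : ℂ → ℂ} {δ C : ℝ} (hδ : 0 ≤ δ)
    (hf : ∀ s : ℂ, s.re ∈ Set.Icc 0 δ → DifferentiableAt ℂ f s)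
    (hC : ∀ s : ℂ, s.re ∈ Set.Icc 0 δ → ‖f s‖ ≤ C * Real.exp (-|s.im|)) :
    ∫ y : ℝ, (f (δ + y * I) - f (y * I)) = 0 := by
  have hint : ∀ x ∈ Set.Icc 0 δ, Integrable fun y : ℝ => f (x + y * I) := fun x hx => by
    refine (integrable_exp_neg_abs.const_mul C).mono' ?_ (.of_forall fun y => ?_)
    · refine (continuous_iff_continuousAt.2 fun y => ?_).aestronglyMeasurable
      exact (hf (x + y * I) (by simpa using hx)).continuousAt.comp
        (f := fun y : ℝ => (x + y * I : ℂ)) (by fun_prop)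
    · simpa using hC (x + y * I) (by simpa using hx)
  have hlim : ∀ x ∈ Set.Icc 0 δ,
      Tendsto (fun T : ℝ => ∫ y in -T..T, f (x + y * I)) atTop (𝓝 (∫ y : ℝ, f (x + y * I))) :=
    fun x hx => intervalIntegral_tendsto_integral (hint x hx) tendsto_neg_atTop_atBot tendsto_id
  have hside : ∀ e : ℝ → ℝ, (∀ T, |e T| = |T|) →
      Tendsto (fun T : ℝ => ∫ x in (0 : ℝ)..δ, f (x + e T * I)) atTop (𝓝 0) := fun e he => by
    have h0 : Tendsto (fun T : ℝ => C * Real.exp (-|T|) * |δ - 0|) atTop (𝓝 0) := by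
      have := (Real.tendsto_exp_neg_atTop_nhds_zero.comp tendsto_abs_atTop_atTop).const_mul C
      simpa using this.mul_const |δ - 0|
    refine squeeze_zero_norm (fun T => ?_) h0
    refine intervalIntegral.norm_integral_le_of_norm_le_const fun x hx => ?_
    rw [Set.uIoc_of_le hδ] at hx
    simpa [he] using hC (x + e T * I) (by simpa using ⟨hx.1.le, hx.2⟩)
  have hrect : ∀ T : ℝ, (((∫ x : ℝ in (0 : ℝ)..δ, f (x + (-T : ℝ) * I)) -
      ∫ x : ℝ in (0 : ℝ)..δ, f (x + T * I)) + I • ∫ y : ℝ in (-T)..T, f (δ + y * I)) -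
        I • ∫ y : ℝ in (-T)..T, f ((0 : ℝ) + y * I) = 0 := fun T => by
    have := integral_boundary_rect_eq_zero_of_differentiableOn f ⟨0, -T⟩ ⟨δ, T⟩ fun s hs => by
      refine (hf s ?_).differentiableWithinAt
      simpa [Set.uIcc_of_le hδ] using hs.1
    simpa using this
  have h1 := (((hside (fun T => -T) (fun T => abs_neg T)).sub
    (hside (fun T => T) (fun T => rfl))).add
    ((hlim δ ⟨hδ, le_rfl⟩).const_smul I)).sub ((hlim 0 ⟨le_rfl, hδ⟩).const_smul I)
  simp only [hrect] at h1
  have h2 := tendsto_nhds_unique h1 tendsto_const_nhds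
  have h3 := integral_sub (hint δ ⟨hδ, le_rfl⟩) (hint 0 ⟨le_rfl, hδ⟩)
  simp only [sub_zero, zero_add, ← smul_sub, smul_eq_zero, I_ne_zero, false_or,
    ofReal_zero] at h2 h3
  exact h3.trans h2

theorem integrable_gammaStrip_mul {p : Fin 4 → ℂ} (hp : ∀ i, 0 < (p i).re) {q : ℂ → ℂ}
    (hq : Continuous q) {B : ℝ} (hB : ∀ y : ℝ, ‖q (y * I)‖ ≤ B * Real.exp |y|) :
    Integrable fun y : ℝ => gammaStrip 0 p (y * I) * q (y * I) := by
  obtain ⟨C, hC0, hC⟩ := exists_norm_gammaStrip_le (δ := 0) hp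
  refine (integrable_exp_neg_abs.const_mul (C * B)).mono' ?_ (.of_forall fun y => ?_)
  · refine (Continuous.mul ?_ (by fun_prop)).aestronglyMeasurable
    refine continuous_iff_continuousAt.2 fun y => ?_
    exact (differentiableAt_gammaStrip hp (s := y * I) (by simp)).continuousAt.comp
        (f := fun y : ℝ => (y * I : ℂ)) (by fun_prop)
  · rw [norm_mul]
    have h1 : ‖gammaStrip 0 p (y * I)‖ ≤ C * Real.exp (-(2 * |y|)) := by
      simpa using hC (y * I) (by simp)
    refine (mul_le_mul h1 (hB y) (norm_nonneg _) (by positivity)).trans (le_of_eq ?_)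
    rw [mul_mul_mul_comm, ← Real.exp_add]
    ring_nf

/-- The contour shift behind the moment relations. If `q (1 - s) = q s`, moving the integral of
`sin (2πs) q(s) ∏ᵢ Γ(pᵢ + s) Γ(pᵢ + 1 - s)` from `Re s = 0` to `Re s = 1` shows that the
odd part of `∏ᵢ (pᵢ - s) q(s)` has integral zero against the kernel `gammaStrip 0 p`. -/
theorem integral_gammaStrip_shift {p : Fin 4 → ℂ} (hp : ∀ i, 0 < (p i).re) {q : ℂ → ℂ}
    (hq : Differentiable ℂ q) (hsymm : ∀ s, q (1 + s) = q (-s)) {B : ℝ}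
    (hB : ∀ s : ℂ, s.re ∈ Set.Icc 0 1 → ‖q s‖ ≤ B * Real.exp |s.im|) :
    ∫ y : ℝ, gammaStrip 0 p (y * I) *
      ((∏ i, (p i + y * I)) * q (-(y * I)) - (∏ i, (p i - y * I)) * q (y * I)) = 0 := by
  obtain ⟨C, hC0, hC⟩ := exists_norm_gammaStrip_le (δ := 1) hp
  have key := integral_vertical_sub_eq_zero (f := fun s => gammaStrip 1 p s * q s) (δ := 1)
    (C := C * B) zero_le_one
    (fun s hs => (differentiableAt_gammaStrip hp hs).mul (hq s)) fun s hs => by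
      rw [norm_mul]
      refine (mul_le_mul (hC s hs) (hB s hs) (norm_nonneg _) (by positivity)).trans (le_of_eq ?_)
      rw [mul_mul_mul_comm, ← Real.exp_add]
      ring_nf
  have hG : ∀ z : ℂ, 0 < z.re → Gamma (z + 1) = z * Gamma z := fun z hz =>
    Gamma_add_one z (by rintro rfl; simp at hz)
  have h0 : ∀ y : ℝ, gammaStrip 1 p (y * I) =
      gammaStrip 0 p (y * I) * ∏ i, (p i - y * I) := fun y => by
    rw [gammaStrip, gammaStrip, mul_assoc (sin _), ← Finset.prod_mul_distrib]
    congr 1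
    refine Finset.prod_congr rfl fun i _ => ?_
    have := hG (p i - y * I) (by simpa using hp i)
    rw [ofReal_one, add_sub_right_comm, this, ofReal_zero, add_zero]
    ring
  have h1 : ∀ y : ℝ, gammaStrip 1 p (1 + y * I) =
      gammaStrip 0 p (y * I) * ∏ i, (p i + y * I) := fun y => by
    have hs : sin (2 * Real.pi * (1 + y * I)) = sin (2 * Real.pi * (y * I)) := by
      rw [mul_add, mul_one, add_comm, sin_add_two_pi]
    rw [gammaStrip, gammaStrip, mul_assoc (sin _), ← Finset.prod_mul_distrib, hs]
    congr 1
    refine Finset.prod_congr rfl fun i _ => ?_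
    have := hG (p i + y * I) (by simpa using hp i)
    rw [show p i + (1 + y * I) = p i + y * I + 1 by ring, this, ofReal_one, ofReal_zero,
      show p i + 1 - (1 + y * I) = p i + 0 - y * I by ring]
    ring
  simpa only [ofReal_one, h0, h1, hsymm, mul_sub, ← mul_assoc] using key

/-! ### Relations between the moments -/

theorem integral_eq_two_mul_integral_Ioi_of_even {f : ℝ → ℂ} (hf : Integrable f)
    (he : ∀ y, f (-y) = f y) : ∫ y, f y = 2 * ∫ y in Set.Ioi 0, f y := by
  have h := integral_comp_neg_Iic 0 f
  simp only [he, neg_zero] at h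
  rw [← intervalIntegral.integral_Iic_add_Ioi hf.integrableOn hf.integrableOn (b := 0), h, two_mul]

/-- The integrand of the `k`-th moment after the substitution `x = y²`, up to a constant. The power
`x ^ k` is written `(-s²) ^ k` with `s = iy`. -/
noncomputable def momentKernel (p : Fin 4 → ℂ) (k : ℕ) (y : ℝ) : ℂ :=
  gammaStrip 0 p (y * I) * (y * I * (-(y * I) ^ 2) ^ k)

theorem integrable_momentKernel {p : Fin 4 → ℂ} (hp : ∀ i, 0 < (p i).re) (k : ℕ) :
    Integrable (momentKernel p k) := by
  refine integrable_gammaStrip_mul hp (q := fun s => s * (-s ^ 2) ^ k) (by fun_prop)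
    (B := (2 * k + 1).factorial) fun y => ?_
  have h := Real.pow_div_factorial_le_exp |y| (abs_nonneg y) (2 * k + 1)
  rw [div_le_iff₀ (by positivity), mul_comm (Real.exp _)] at h
  refine le_trans (le_of_eq ?_) h
  simp only [norm_mul, norm_pow, norm_neg, norm_real, norm_I, mul_one, Real.norm_eq_abs]
  ring

theorem momentKernel_neg (p : Fin 4 → ℂ) (k : ℕ) (y : ℝ) :
    momentKernel p k (-y) = momentKernel p k y := by
  have h : gammaStrip 0 p (-(y * I)) = -gammaStrip 0 p (y * I) := by
    rw [gammaStrip, gammaStrip, mul_neg, sin_neg, neg_mul]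
    congr 2
    refine Finset.prod_congr rfl fun i _ => ?_
    rw [ofReal_zero, add_zero, sub_neg_eq_add, ← sub_eq_add_neg, mul_comm]
  simp only [momentKernel, ofReal_neg, neg_mul, h, neg_sq]
  ring

/-- The contour shift with `q = 1`: the odd part of `∏ᵢ (pᵢ - s)` is `-(e₃ s + e₁ s³)`, where the
`eⱼ` are the elementary symmetric functions of the `pᵢ`. -/
theorem first_moment_relation {p : Fin 4 → ℂ} (hp : ∀ i, 0 < (p i).re) :
    (p 0 * p 1 * p 2 + p 0 * p 1 * p 3 + p 0 * p 2 * p 3 + p 1 * p 2 * p 3) *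
        ∫ y, momentKernel p 0 y =
      (p 0 + p 1 + p 2 + p 3) * ∫ y, momentKernel p 1 y := by
  have key := integral_gammaStrip_shift hp (q := fun _ => 1) (by fun_prop) (fun _ => rfl)
    (B := 1) fun s _ => by simp
  have h0 := integrable_momentKernel hp 0
  have h1 := integrable_momentKernel hp 1
  rw [← integral_const_mul, ← integral_const_mul, ← sub_eq_zero,
    ← integral_sub (h0.const_mul _) (h1.const_mul _)]
  rw [← mul_eq_zero_iff_left (two_ne_zero' ℂ), ← integral_const_mul, ← key]
  refine integral_congr_ae (.of_forall fun y => ?_)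
  simp only [momentKernel, Fin.prod_univ_four]
  ring

/-- The contour shift with `q = s (1 - s)`: the odd part of `∏ᵢ (pᵢ - s) s (1 - s)` is
`e₄ s + (e₂ + e₃) s³ + (1 + e₁) s⁵`. -/
theorem second_moment_relation {p : Fin 4 → ℂ} (hp : ∀ i, 0 < (p i).re) :
    p 0 * p 1 * p 2 * p 3 * (∫ y, momentKernel p 0 y) +
        (1 + (p 0 + p 1 + p 2 + p 3)) * ∫ y, momentKernel p 2 y =
      (p 0 * p 1 + p 0 * p 2 + p 0 * p 3 + p 1 * p 2 + p 1 * p 3 + p 2 * p 3 +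
        (p 0 * p 1 * p 2 + p 0 * p 1 * p 3 + p 0 * p 2 * p 3 + p 1 * p 2 * p 3)) *
          ∫ y, momentKernel p 1 y := by
  have key := integral_gammaStrip_shift hp (q := fun s => s * (1 - s)) (by fun_prop)
    (fun s => by ring) (B := 4) fun s hs => by
      have h1 : ‖s‖ ≤ 1 + |s.im| := by
        refine (norm_le_abs_re_add_abs_im s).trans ?_
        rw [abs_of_nonneg hs.1]; linarith [hs.2]
      have h2 : ‖1 - s‖ ≤ 1 + |s.im| := by
        refine (norm_le_abs_re_add_abs_im _).trans ?_
        rw [sub_re, one_re, sub_im, one_im, zero_sub, abs_neg, abs_of_nonneg (by linarith [hs.2])]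
        linarith [hs.1]
      -- `(1 + t)² ≤ 4 (1 + t/2)² ≤ 4 exp t`
      have h3 : Real.exp |s.im| = Real.exp (|s.im| / 2) ^ 2 := by
        rw [← Real.exp_nat_mul]; congr 1; push_cast; ring
      have h4 := Real.add_one_le_exp (|s.im| / 2)
      rw [norm_mul, h3]
      nlinarith [norm_nonneg s, norm_nonneg (1 - s), abs_nonneg s.im]
  have h0 := integrable_momentKernel hp 0
  have h1 := integrable_momentKernel hp 1
  have h2 := integrable_momentKernel hp 2
  have h02 : Integrable fun y => p 0 * p 1 * p 2 * p 3 * momentKernel p 0 y +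
      (1 + (p 0 + p 1 + p 2 + p 3)) * momentKernel p 2 y := (h0.const_mul _).add (h2.const_mul _)
  rw [← integral_const_mul, ← integral_const_mul, ← integral_const_mul, ← sub_eq_zero,
    ← integral_add (h0.const_mul _) (h2.const_mul _), ← integral_sub h02 (h1.const_mul _)]
  rw [← mul_eq_zero_iff_left (neg_ne_zero.2 (two_ne_zero' ℂ)), ← integral_const_mul, ← key]
  refine integral_congr_ae (.of_forall fun y => ?_)
  simp only [momentKernel, Fin.prod_univ_four]
  ring

/-! ### The Wilson density and its moments -/

theorem inv_norm_Gamma_two_mul_I_sq {y : ℝ} (hy : 0 < y) :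
    ((‖Gamma (2 * I * y)‖ ^ 2 : ℝ) : ℂ)⁻¹ =
      -(2 * (y * I) * sin (2 * Real.pi * (y * I)) / Real.pi) := by
  have hz : (2 * I * y : ℂ) ≠ 0 := by simp [hy.ne']
  have hc : starRingEnd ℂ (2 * I * y) = -(2 * I * y) := by
    rw [map_mul, map_mul, map_ofNat, conj_I, conj_ofReal]; ring
  have h1 := Gamma_mul_Gamma_one_sub (2 * I * y)
  rw [sub_eq_neg_add, Gamma_add_one _ (neg_ne_zero.2 hz)] at h1
  rw [ofReal_pow, ← mul_conj', ← Gamma_conj, hc]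
  have h2 : Gamma (2 * I * y) * Gamma (-(2 * I * y)) =
      (Real.pi / sin (Real.pi * (2 * I * y))) / (-(2 * I * y)) := by
    rw [← h1, eq_div_iff (neg_ne_zero.2 hz)]; ring
  rw [h2, inv_div, div_div_eq_mul_div,
    show (2 * Real.pi * (y * I) : ℂ) = Real.pi * (2 * I * y) by ring]
  ring

/-- Conjugation permutes admissible parameters, so it may be dropped inside a product over them. -/
theorem WilsonAdmissible.prod_Gamma_conj_sub {a b c d : ℂ} (h : WilsonAdmissible a b c d) (s : ℂ) :
    Gamma (starRingEnd ℂ a - s) * Gamma (starRingEnd ℂ b - s) * Gamma (starRingEnd ℂ c - s) *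
      Gamma (starRingEnd ℂ d - s) =
    Gamma (a - s) * Gamma (b - s) * Gamma (c - s) * Gamma (d - s) := by
  have e : ∀ z w : ℂ, RealOrConjPair z w →
      Gamma (starRingEnd ℂ z - s) * Gamma (starRingEnd ℂ w - s) =
        Gamma (z - s) * Gamma (w - s) := by
    rintro z w (⟨hz, hw⟩ | rfl)
    · rw [conj_eq_iff_im.2 hz, conj_eq_iff_im.2 hw]
    · rw [conj_conj, mul_comm]
  rcases h.pairs with ⟨h1, h2⟩ | ⟨h1, h2⟩ | ⟨h1, h2⟩ <;>
  · have := congrArg₂ (· * ·) (e _ _ h1) (e _ _ h2)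
    linear_combination this

theorem two_mul_wilsonDensity_sq {a b c d : ℂ} (h : WilsonAdmissible a b c d) {y : ℝ}
    (hy : 0 < y) (k : ℕ) :
    ((2 * y * (wilsonDensity a b c d (y ^ 2) * (y ^ 2) ^ k) : ℝ) : ℂ) =
      -(4 * (wilsonK a b c d).re / Real.pi) * momentKernel ![a, b, c, d] k y := by
  have hN : ((‖Gamma (a + I * y) * Gamma (b + I * y) * Gamma (c + I * y) * Gamma (d + I * y)‖ ^ 2
      : ℝ) : ℂ) = ∏ i, (Gamma (![a, b, c, d] i + y * I) * Gamma (![a, b, c, d] i - y * I)) := by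
    have h1 := h.prod_Gamma_conj_sub (y * I)
    rw [ofReal_pow, ← mul_conj']
    simp only [map_mul, ← Gamma_conj, map_add, conj_I, conj_ofReal, Fin.prod_univ_four]
    simp only [neg_mul, ← sub_eq_add_neg, mul_comm I (y : ℂ)]
    rw [h1]
    simp
    ring
  have hG := inv_norm_Gamma_two_mul_I_sq hy
  have hy' : (y : ℂ) ≠ 0 := ofReal_ne_zero.2 hy.ne'
  rw [wilsonDensity, Real.sqrt_sq hy.le, momentKernel, gammaStrip]
  generalize ‖_ * Gamma (d + I * y)‖ ^ 2 = N at hN ⊢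
  generalize ‖Gamma (2 * I * y)‖ ^ 2 = G at hG ⊢
  have hI : (-(y * I : ℂ) ^ 2) = y ^ 2 := by rw [mul_pow, I_sq]; ring
  rw [hI]
  push_cast
  rw [hN, div_eq_mul_inv, mul_inv, hG]
  simp only [add_zero]
  field_simp
  ring

theorem integrableOn_wilsonDensity_mul_pow {a b c d : ℂ} (h : WilsonAdmissible a b c d) (k : ℕ) :
    IntegrableOn (fun x => wilsonDensity a b c d x * x ^ k) (Set.Ioi 0) := by
  have hp : ∀ i, 0 < (![a, b, c, d] i).re := by
    simpa [Fin.forall_fin_succ] using ⟨h.re_a, h.re_b, h.re_c, h.re_d⟩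
  rw [← integrableOn_Ioi_comp_rpow_iff _ two_ne_zero]
  have := ((integrable_momentKernel hp k).const_mul
    (-(4 * (wilsonK a b c d).re / Real.pi))).re.integrableOn (s := Set.Ioi 0)
  refine this.congr_fun (fun y hy => ?_) measurableSet_Ioi
  simp only [← two_mul_wilsonDensity_sq h hy k, RCLike.re_eq_complex_re, ofReal_re]
  norm_num

theorem integral_wilsonDensity_mul_pow {a b c d : ℂ} (h : WilsonAdmissible a b c d) (k : ℕ) :
    ((∫ x in Set.Ioi 0, wilsonDensity a b c d x * x ^ k : ℝ) : ℂ) =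
      -(2 * (wilsonK a b c d).re / Real.pi) * ∫ y, momentKernel ![a, b, c, d] k y := by
  have hp : ∀ i, 0 < (![a, b, c, d] i).re := by
    simpa [Fin.forall_fin_succ] using ⟨h.re_a, h.re_b, h.re_c, h.re_d⟩
  rw [← integral_comp_rpow_Ioi _ two_ne_zero, ← integral_complex_ofReal,
    integral_eq_two_mul_integral_Ioi_of_even (integrable_momentKernel hp k) (momentKernel_neg _ k),
    ← mul_assoc, ← integral_const_mul]
  refine setIntegral_congr_fun measurableSet_Ioi fun y hy => ?_
  have := two_mul_wilsonDensity_sq h hy k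
  rw [show (-(2 * (wilsonK a b c d).re / Real.pi) * 2 : ℂ) =
    -(4 * (wilsonK a b c d).re / Real.pi) by ring, ← this]
  norm_num

/-! ### Random variables with Wilson density -/

/-- The sign of the density is that of the constant `(wilsonK a b c d).re`. Were it not positive,
`ENNReal.ofReal` would truncate the density to zero and the law of `X` would have no mass. -/
theorem wilsonDensity_nonneg_of_map_eq {Ω : Type*} [MeasurableSpace Ω] {P : Measure Ω}
    [IsProbabilityMeasure P] {a b c d : ℂ} {X : Ω → ℝ} (hX : AEMeasurable X P)
    (hdens : P.map X = (volume.restrict (Set.Ioi (0 : ℝ))).withDensity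
      (fun x => ENNReal.ofReal (wilsonDensity a b c d x))) (x : ℝ) :
    0 ≤ wilsonDensity a b c d x := by
  rcases le_total 0 (wilsonK a b c d).re with hK | hK
  · exact mul_nonneg hK (by positivity)
  · have hz : (fun x => ENNReal.ofReal (wilsonDensity a b c d x)) = 0 := funext fun x =>
      ENNReal.ofReal_of_nonpos (mul_nonpos_of_nonpos_of_nonneg hK (by positivity))
    have := Measure.isProbabilityMeasure_map hX
    rw [hz, withDensity_zero] at hdens
    exact absurd hdens (IsProbabilityMeasure.ne_zero _)

theorem integrable_pow_and_integral_pow_of_map_eq {Ω : Type*} [MeasurableSpace Ω] {P : Measure Ω}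
    [IsProbabilityMeasure P] {a b c d : ℂ} (habcd : WilsonAdmissible a b c d)
    {X : Ω → ℝ} (hX : AEMeasurable X P)
    (hdens : P.map X = (volume.restrict (Set.Ioi (0 : ℝ))).withDensity
      (fun x => ENNReal.ofReal (wilsonDensity a b c d x))) (k : ℕ) :
    Integrable (fun ω => X ω ^ k) P ∧
      ∫ ω, X ω ^ k ∂P = ∫ x in Set.Ioi 0, wilsonDensity a b c d x * x ^ k := by
  have hm : AEMeasurable (fun x => ENNReal.ofReal (wilsonDensity a b c d x))
      (volume.restrict (Set.Ioi (0 : ℝ))) := by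
    simpa using (integrableOn_wilsonDensity_mul_pow habcd 0).aemeasurable.ennreal_ofReal
  have hr : ∀ x, (ENNReal.ofReal (wilsonDensity a b c d x)).toReal = wilsonDensity a b c d x :=
    fun x => ENNReal.toReal_ofReal (wilsonDensity_nonneg_of_map_eq hX hdens x)
  have hc : AEStronglyMeasurable (fun x : ℝ => x ^ k) (P.map X) :=
    (continuous_pow k).aestronglyMeasurable
  constructor
  · refine (integrable_map_measure hc hX).1 ?_
    rw [hdens, integrable_withDensity_iff_integrable_smul₀' hm (by simp)]
    simpa only [hr, smul_eq_mul, IntegrableOn] using integrableOn_wilsonDensity_mul_pow habcd k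
  · rw [← integral_map hX hc, hdens, integral_withDensity_eq_integral_toReal_smul₀ hm (by simp)]
    simp only [hr, smul_eq_mul]

theorem proposition2p1 {Ω : Type*} [MeasurableSpace Ω] (P : MeasureTheory.Measure Ω)
    [MeasureTheory.IsProbabilityMeasure P] (a b c d : ℂ) (habcd : WilsonAdmissible a b c d)
    (X : Ω → ℝ) (hX : AEMeasurable X P)
    (hdens : P.map X = (MeasureTheory.volume.restrict (Set.Ioi (0 : ℝ))).withDensity
      (fun x => ENNReal.ofReal (wilsonDensity a b c d x))) :
    MeasureTheory.MemLp X 2 P ∧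
    ((∫ ω, X ω ∂P : ℝ) : ℂ) =
      (a * b * c + a * b * d + a * c * d + b * c * d) / (a + b + c + d) ∧
    ((ProbabilityTheory.variance X P : ℝ) : ℂ) =
      ((a + b) * (a + c) * (b + c) * (a + d) * (b + d) * (c + d)) /
        ((a + b + c + d) ^ 2 * (a + b + c + d + 1)) := by
  have hL : MemLp X 2 P := (memLp_two_iff_integrable_sq hX.aestronglyMeasurable).2
    (integrable_pow_and_integral_pow_of_map_eq habcd hX hdens 2).1
  have hp : ∀ i, 0 < (![a, b, c, d] i).re := by
    simpa [Fin.forall_fin_succ] using ⟨habcd.re_a, habcd.re_b, habcd.re_c, habcd.re_d⟩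
  have hE : ∀ k, ((∫ ω, X ω ^ k ∂P : ℝ) : ℂ) =
      -(2 * (wilsonK a b c d).re / Real.pi) * ∫ y, momentKernel ![a, b, c, d] k y := fun k => by
    rw [(integrable_pow_and_integral_pow_of_map_eq habcd hX hdens k).2,
      integral_wilsonDensity_mul_pow habcd]
  -- The case `k = 0` is the total mass, which replaces the evaluation of the Wilson integral.
  have hE0 := hE 0
  have hE1 := hE 1
  have hE2 := hE 2
  simp only [pow_zero, integral_const, probReal_univ, one_smul, ofReal_one] at hE0
  simp only [pow_one] at hE1
  have r1 := first_moment_relation hp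
  have r2 := second_moment_relation hp
  simp only [Matrix.cons_val] at r1 r2
  have hs : a + b + c + d ≠ 0 := fun h => by
    have := congrArg re h
    simp only [add_re, zero_re] at this
    linarith [habcd.re_a, habcd.re_b, habcd.re_c, habcd.re_d]
  have hs1 : a + b + c + d + 1 ≠ 0 := fun h => by
    have := congrArg re h
    simp only [add_re, zero_re, one_re] at this
    linarith [habcd.re_a, habcd.re_b, habcd.re_c, habcd.re_d]
  set κ : ℂ := -(2 * (wilsonK a b c d).re / Real.pi)
  have m1 : ((∫ ω, X ω ∂P : ℝ) : ℂ) =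
      (a * b * c + a * b * d + a * c * d + b * c * d) / (a + b + c + d) := by
    rw [eq_div_iff hs, hE1]
    linear_combination (-κ) * r1 - (a * b * c + a * b * d + a * c * d + b * c * d) * hE0
  have m2 : ((∫ ω, X ω ^ 2 ∂P : ℝ) : ℂ) =
      ((a * b + a * c + a * d + b * c + b * d + c * d +
        (a * b * c + a * b * d + a * c * d + b * c * d)) *
          ((a * b * c + a * b * d + a * c * d + b * c * d) / (a + b + c + d)) - a * b * c * d) /
        (a + b + c + d + 1) := by
    rw [eq_div_iff hs1, ← m1, hE1, hE2]
    linear_combination κ * r2 + a * b * c * d * hE0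
  refine ⟨hL, m1, ?_⟩
  -- `e₁ e₂ e₃ - e₁² e₄ - e₃²` is the product of the six sums of two parameters.
  rw [ProbabilityTheory.variance_eq_sub hL]
  simp only [Pi.pow_apply]
  rw [ofReal_sub, ofReal_pow, m1, m2]
  field_simp
  ring
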